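/- Let $\mathcal X$ be a nonempty finite set and let $\mathcal Y,\mathcal V$ be finite subsets of an abelian group. Consider a channel with conditional laws $p(y_i\mid x^i,y^{i-1})$, $i\ge 1$, with input alphabet $\mathcal X$ and output alphabet $\mathcal Y$ and arbitrary memory, together with the additive noise feedback link $Z_i=Y_i+V_i$, where $(V_i)_{i\ge1}$ is an arbitrary $\mathcal V$-valued process that is independent of the message and of the forward channel: for every channel input distribution $X=\{p(x_i\mid x^{i-1},z^{i-1})\}_{i\ge1}$, $$p(x^n,y^n,v^n)=p(v^n)\prod_{i=1}^n p(x_i\mid x^{i-1},z^{i-1})\,p(y_i\mid x^i,y^{i-1}),\qquad z_j=y_j+v_j .$$ Logarithms are to base $2$. An $(n,M,\epsilon)$ code consists of an encoder, which assigns to each message $w\in\{1,\dots,M\}$ maps $f_i[w]:\mathcal Z^{i-1}\to\mathcal X$, $1\le i\le n$, where $\mathcal Z=\mathcal Y+\mathcal V$ (the input at time $i$ is $x_i=f_i[w](z^{i-1})$), and a decoder $g:\mathcal Y^n\to\{1,\dots,M\}$, such that the average error probability $\frac1M\sum_w \Pr(g(Y^n)\ne w\mid w)$ is at most $\epsilon$.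 A rate $R\ge0$ is achievable if for every $\epsilon>0$ and all sufficiently large $n$ there is an $(n,M,\epsilon)$ code with $\frac1n\log M\ge R-\epsilon$; the capacity $C_{FB}^{noise}$ is the supremum of the achievable rates. The strong converse property holds if for every $R>C_{FB}^{noise}$ and every sequence of codes with message numbers $M_n$, $n\geq 1$, and $\liminf_n\frac1n\log M_n\ge R$ the error probabilities tend to $1$. Theorem. If the channel with this independent additive noise feedback has the strong converse property, then $$C_{FB}^{noise}\;\ge\;\sup_X\liminf_{n\to\infty}\frac1n I(X^n\to Y^n\mid V^n)\;-\;\limsup_{n\to\infty}\frac1n H(V^n),$$ where the supremum is over all channel input distributions $X$, and $I(X^n\to Y^n\mid V^n)=\sum_{i=1}^n I(X^i;Y_i\mid Y^{i-1},V^n)$ is the conditional directed information. -/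

import Mathlib

open scoped Pointwise

noncomputable section

/-! ### Entropy of finite-valued random variables (logarithms to base 2)

`p : Ω → ℝ` is the mass function of a finite probability space and random variables are functions
on `Ω`. -/

namespace FiniteInfo

variable {Ω α β γ : Type*} [Fintype Ω] [Fintype α] [Fintype β] [Fintype γ]

/-- Shannon entropy of a mass function, in bits. -/
def massEntropy (p : Ω → ℝ) : ℝ :=
  -∑ ω, p ω * Real.logb 2 (p ω)

open Classical in
/-- Mass function of the random variable `f`. -/
def law (p : Ω → ℝ) (f : Ω → α) (a : α) : ℝ :=
  ∑ ω with f ω = a, p ω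

/-- `H(f)`. -/
def entropy (p : Ω → ℝ) (f : Ω → α) : ℝ :=
  massEntropy (law p f)

/-- `H(f | g) = H(f, g) - H(g)`. -/
def condEntropy (p : Ω → ℝ) (f : Ω → α) (g : Ω → β) : ℝ :=
  entropy p (fun ω => (f ω, g ω)) - entropy p g

/-- `I(f ; g | h) = H(g | h) - H(g | f, h)`. -/
def condMutualInfo (p : Ω → ℝ) (f : Ω → α) (g : Ω → β) (h : Ω → γ) : ℝ :=
  condEntropy p g h - condEntropy p g (fun ω => (f ω, h ω))

end FiniteInfo

/-- A channel with input alphabet `X` and output alphabet `Y`, with arbitrary memory, together with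
a feedback link with additive noise `V_i` taking values in `V`. The alphabets `Y` and `V` are finite
subsets of an abelian group, in which the sum `Y_i + V_i` is formed. Time starts at `0`:
`forward i (x_0, …, x_i) (y_0, …, y_{i-1})` is the conditional law of the output `Y_i`, and
`noise i (v_0, …, v_{i-1})` is the conditional law of `V_i` given the past noise (an arbitrary
process with values in `V`). -/
structure AdditiveNoiseFeedbackChannel (X : Type*) {A : Type*} (Y V : Finset A) where
  forward : (i : ℕ) → (Fin (i + 1) → X) → (Fin i → Y) → PMF Y
  noise : (i : ℕ) → (Fin i → V) → PMF V

/-- The outputs `z_j = y_j + v_j` of the feedback link at the times `j < m`. -/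
def feedback {A : Type*} [AddCommGroup A] [DecidableEq A] {Y V : Finset A} {m : ℕ}
    (y : Fin m → Y) (v : Fin m → V) : Fin m → ↥(Y + V) :=
  fun j => ⟨(y j : A) + (v j : A), Finset.add_mem_add (y j).2 (v j).2⟩

/-- A channel input distribution `{p(x_i | x^{i-1}, z^{i-1})}_i`; the input at time `i` may depend
on the feedback `z_0, …, z_{i-1}` only. -/
abbrev InputDistribution (X Z : Type*) : Type _ :=
  (i : ℕ) → (Fin i → X) → (Fin i → Z) → PMF X

/-- `∏_i p(x_i | x^{i-1}, z^{i-1})`. -/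
def inputMass {X Z : Type*} (q : InputDistribution X Z) (n : ℕ) (x : Fin n → X) (z : Fin n → Z) :
    ℝ :=
  ∏ i : Fin n, (q i (Fin.take i i.is_le' x) (Fin.take i i.is_le' z) (x i)).toReal

/-- A channel code of block length `n` with `M` messages: to each message `w` a code-function, whose
`i`-th component maps the feedback `z_0, …, z_{i-1}` to the channel input `x_i`, and a decoder. -/
structure ChannelCode (X Y Z : Type*) (n M : ℕ) where
  encoder : Fin M → (i : Fin n) → (Fin i → Z) → X
  decoder : (Fin n → Y) → Fin M

/-- The input sequence produced by a code-function on the feedback sequence `z`. -/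
def codeInput {X Z : Type*} {n : ℕ} (f : (i : Fin n) → (Fin i → Z) → X) (z : Fin n → Z) :
    Fin n → X :=
  fun i => f i (Fin.take i i.is_le' z)

namespace AdditiveNoiseFeedbackChannel

variable {X A : Type*} [AddCommGroup A] [DecidableEq A] {Y V : Finset A}

/-- `P(V^n = v^n)`. -/
def noiseMass (K : AdditiveNoiseFeedbackChannel X Y V) (n : ℕ) (v : Fin n → V) : ℝ :=
  ∏ i : Fin n, (K.noise i (Fin.take i i.is_le' v) (v i)).toReal

/-- `∏_i p(y_i | x^i, y^{i-1})`. -/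
def forwardMass (K : AdditiveNoiseFeedbackChannel X Y V) (n : ℕ) (x : Fin n → X) (y : Fin n → Y) :
    ℝ :=
  ∏ i : Fin n, (K.forward i (Fin.take (i + 1) i.is_lt x) (Fin.take i i.is_le' y) (y i)).toReal

/-- The joint mass function of `(X^n, Y^n, V^n)` when the channel is driven by the input distribution
`q`; the noise is independent of everything else that drives the system. -/
def jointMass (K : AdditiveNoiseFeedbackChannel X Y V) (q : InputDistribution X ↥(Y + V)) (n : ℕ) :
    (Fin n → X) × (Fin n → Y) × (Fin n → V) → ℝ :=
  fun ω => K.noiseMass n ω.2.2 * inputMass q n ω.1 (feedback ω.2.1 ω.2.2)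
    * K.forwardMass n ω.1 ω.2.1

/-- The conditional directed information
`I(X^n → Y^n | V^n) = ∑_i I(X^i ; Y_i | Y^{i-1}, V^n)`. -/
def condDirectedInfo [Fintype X] (K : AdditiveNoiseFeedbackChannel X Y V)
    (q : InputDistribution X ↥(Y + V)) (n : ℕ) : ℝ :=
  ∑ i : Fin n, FiniteInfo.condMutualInfo (K.jointMass q n)
    (fun ω => Fin.take (i + 1) i.is_lt ω.1)
    (fun ω => ω.2.1 i)
    (fun ω => (Fin.take i i.is_le' ω.2.1, ω.2.2))

/-- `sup_X liminf_n (1/n) I(X^n → Y^n | V^n)`, the supremum being over all channel input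
distributions. -/
def upperBound [Fintype X] (K : AdditiveNoiseFeedbackChannel X Y V) : EReal :=
  ⨆ q : InputDistribution X ↥(Y + V),
    Filter.liminf (fun n : ℕ => ((K.condDirectedInfo q n / n : ℝ) : EReal)) Filter.atTop

/-- `limsup_n (1/n) H(V^n)`. -/
def noiseEntropyRate (K : AdditiveNoiseFeedbackChannel X Y V) : EReal :=
  Filter.limsup (fun n : ℕ => ((FiniteInfo.massEntropy (K.noiseMass n) / n : ℝ) : EReal))
    Filter.atTop

/-- `p(y^n | w)` when the inputs are produced by the code-function `f` of the message `w`. -/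
def outputMass (K : AdditiveNoiseFeedbackChannel X Y V) {n : ℕ}
    (f : (i : Fin n) → (Fin i → ↥(Y + V)) → X) (y : Fin n → Y) : ℝ :=
  ∑ v : Fin n → V, K.noiseMass n v * K.forwardMass n (codeInput f (feedback y v)) y

/-- The average probability of error `(1/M) ∑_w p(g(y^n) ≠ w | w)` of a code. -/
def errorProb (K : AdditiveNoiseFeedbackChannel X Y V) {n M : ℕ}
    (c : ChannelCode X Y ↥(Y + V) n M) : ℝ :=
  (∑ w : Fin M, ∑ y with c.decoder y ≠ w, K.outputMass (c.encoder w) y) / M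

/-- `R ≥ 0` is achievable if for every `ε > 0` there is, for all sufficiently large `n`, a code of
block length `n` with error probability at most `ε` and rate at least `R - ε`. -/
def IsAchievable (K : AdditiveNoiseFeedbackChannel X Y V) (R : ℝ) : Prop :=
  0 ≤ R ∧ ∀ ε : ℝ, 0 < ε → ∀ᶠ n : ℕ in Filter.atTop,
    ∃ (M : ℕ) (c : ChannelCode X Y ↥(Y + V) n M),
      K.errorProb c ≤ ε ∧ R - ε ≤ Real.logb 2 M / n

/-- The noisy feedback capacity: the supremum of all achievable rates. -/
def capacity (K : AdditiveNoiseFeedbackChannel X Y V) : EReal :=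
  sSup {r : EReal | ∃ R : ℝ, K.IsAchievable R ∧ r = (R : EReal)}

/-- The strong converse property: along every sequence of codes whose asymptotic rate is at least
some `R` above the capacity, the error probability tends to one. -/
def StrongConverse (K : AdditiveNoiseFeedbackChannel X Y V) : Prop :=
  ∀ R : ℝ, K.capacity < (R : EReal) →
    ∀ (M : ℕ → ℕ) (c : (n : ℕ) → ChannelCode X Y ↥(Y + V) n (M n)),
      (R : EReal) ≤ Filter.liminf (fun n : ℕ => ((Real.logb 2 (M n) / n : ℝ) : EReal))
        Filter.atTop →
      Filter.Tendsto (fun n => K.errorProb (c n)) Filter.atTop (nhds 1)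

end AdditiveNoiseFeedbackChannel

end

/-! Replace the input distribution by a random strategy G, which fixes in advance an independent
choice of next input for every past of inputs and feedback. G is independent of the noise, and
following it reproduces the given joint law (`law_strategyMass`). Given G, the inputs X^i are a
function of Y^{i-1} and V^n, so the chain rule gives I(X^n → Y^n | V^n) ≤ I(G; Y^n | V^n).
Independence of G and V^n together with elementary entropy inequalities bounds this by I(G; Y^n) +
H(V^n) (`condDirectedInfo_sub_le`).

Now G → Y^n is an ordinary finite channel whose inputs are code-functions. Feinstein's bound
(`exists_code`) yields about 2^{nR} codewords with error at most 1 - t + 2^{-nδ}, where t is the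
probability that the information density exceeds n(R + δ). No information stability is available, so
t need not approach 1. But if I(G; Y^n) ≥ n(R + 2δ), then t stays above a positive constant for
large n, because the part of the mean carried by large densities is controlled by t n log |Y| up to
a constant (`mutualInfo_le`).

Thus if the left side exceeded some R > C, there would be codes of rate R with error bounded away
from 1, contrary to the strong converse. -/

open scoped Pointwise

/-! ### Entropy calculus on finite spaces -/

namespace FiniteInfo

variable {Ω α β γ : Type*} [Fintype Ω] [Fintype α] [Fintype β] [Fintype γ]

open Classical in
theorem law_eq_sum_ite (p : Ω → ℝ) (f : Ω → α) (a : α) :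
    law p f a = ∑ ω, if f ω = a then p ω else 0 := by
  rw [law, Finset.sum_filter]

theorem law_nonneg {p : Ω → ℝ} (hp : ∀ ω, 0 ≤ p ω) (f : Ω → α) (a : α) : 0 ≤ law p f a :=
  Finset.sum_nonneg fun ω _ => hp ω

theorem le_law_apply {p : Ω → ℝ} (hp : ∀ ω, 0 ≤ p ω) (f : Ω → α) (ω : Ω) :
    p ω ≤ law p f (f ω) := by
  classical
  unfold law
  exact Finset.single_le_sum (f := p) (fun i _ => hp i) (by simp)

/-- Change of variables. -/
theorem sum_law_mul (p : Ω → ℝ) (f : Ω → α) (F : α → ℝ) :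
    ∑ a, law p f a * F a = ∑ ω, p ω * F (f ω) := by
  classical
  simp_rw [law_eq_sum_ite, Finset.sum_mul]
  rw [Finset.sum_comm]
  refine Finset.sum_congr rfl fun ω _ => ?_
  simp [ite_mul]

theorem sum_law (p : Ω → ℝ) (f : Ω → α) : ∑ a, law p f a = ∑ ω, p ω := by
  simpa using sum_law_mul p f fun _ => 1

theorem law_law (p : Ω → ℝ) (f : Ω → α) (g : α → β) :
    law (law p f) g = law p (fun ω => g (f ω)) := by
  classical
  funext b
  have h := sum_law_mul p f fun a => if g a = b then 1 else 0
  simpa [law_eq_sum_ite] using h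

theorem law_comp_of_injective (p : Ω → ℝ) (f : Ω → α) {e : α → β} (he : Function.Injective e)
    (a : α) : law p (fun ω => e (f ω)) (e a) = law p f a := by
  classical
  simp only [law_eq_sum_ite, he.eq_iff]

theorem sum_law_fst (p : Ω → ℝ) (f : Ω → α) (h : Ω → γ) (c : γ) :
    ∑ a, law p (fun ω => (f ω, h ω)) (a, c) = law p h c := by
  classical
  simp_rw [law_eq_sum_ite]
  rw [Finset.sum_comm]
  refine Finset.sum_congr rfl fun ω _ => ?_
  simp [Prod.mk.injEq, ite_and]

theorem entropy_eq_sum (p : Ω → ℝ) (f : Ω → α) :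
    entropy p f = -∑ ω, p ω * Real.logb 2 (law p f (f ω)) := by
  rw [entropy, massEntropy, sum_law_mul]

theorem entropy_law (p : Ω → ℝ) (f : Ω → α) (g : α → β) :
    entropy (law p f) g = entropy p (fun ω => g (f ω)) := by
  rw [entropy, law_law, entropy]

theorem condEntropy_law (p : Ω → ℝ) (φ : Ω → α) (f : α → β) (g : α → γ) :
    condEntropy (law p φ) f g = condEntropy p (fun ω => f (φ ω)) (fun ω => g (φ ω)) := by
  rw [condEntropy, condEntropy, entropy_law, entropy_law]

theorem entropy_comp_of_injective (p : Ω → ℝ) (f : Ω → α) {e : α → β}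
    (he : Function.Injective e) : entropy p (fun ω => e (f ω)) = entropy p f := by
  simp_rw [entropy_eq_sum, law_comp_of_injective p f he]

theorem logb_two_le {x : ℝ} (hx : 0 < x) : Real.logb 2 x ≤ (x - 1) / Real.log 2 := by
  rw [Real.logb]
  have := Real.log_pos (one_lt_two)
  gcongr
  exact Real.log_le_sub_one_of_pos hx

/-- Strong subadditivity of entropy. -/
theorem entropy_submodular {p : Ω → ℝ} (hp : ∀ ω, 0 ≤ p ω) (f : Ω → α) (g : Ω → β) (h : Ω → γ) :
    entropy p (fun ω => (f ω, g ω, h ω)) + entropy p h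
      ≤ entropy p (fun ω => (f ω, h ω)) + entropy p (fun ω => (g ω, h ω)) := by
  set A := law p (fun ω => (f ω, g ω, h ω)) with hA
  set B := law p h with hB
  set C := law p (fun ω => (f ω, h ω)) with hC
  set D := law p (fun ω => (g ω, h ω)) with hD
  have hl := Real.log_pos (one_lt_two)
  have A0 : ∀ x, 0 ≤ A x := law_nonneg hp _
  have B0 : ∀ x, 0 ≤ B x := law_nonneg hp _
  have C0 : ∀ x, 0 ≤ C x := law_nonneg hp _
  have D0 : ∀ x, 0 ≤ D x := law_nonneg hp _
  -- Likelihood ratio of the law making f and g conditionally independent given h against the true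
  -- law; its mean is at most the total mass, and log z ≤ z - 1 does the rest.
  let F : α × β × γ → ℝ := fun x => C (x.1, x.2.2) * D x.2 / (A x * B x.2.2)
  have key : ∀ ω, p ω * Real.logb 2 (C (f ω, h ω)) + p ω * Real.logb 2 (D (g ω, h ω))
      - p ω * Real.logb 2 (A (f ω, g ω, h ω)) - p ω * Real.logb 2 (B (h ω))
      ≤ (p ω * F (f ω, g ω, h ω) - p ω) / Real.log 2 := by
    intro ω
    rcases (hp ω).eq_or_lt with h0 | h0
    · simp [← h0]
    have hAp : 0 < A (f ω, g ω, h ω) := h0.trans_le (le_law_apply hp _ ω)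
    have hBp : 0 < B (h ω) := h0.trans_le (le_law_apply hp _ ω)
    have hCp : 0 < C (f ω, h ω) := h0.trans_le (le_law_apply hp (fun ω => (f ω, h ω)) ω)
    have hDp : 0 < D (g ω, h ω) := h0.trans_le (le_law_apply hp (fun ω => (g ω, h ω)) ω)
    have h1 := logb_two_le (x := F (f ω, g ω, h ω)) (by positivity)
    have h2 : Real.logb 2 (F (f ω, g ω, h ω)) = Real.logb 2 (C (f ω, h ω))
        + Real.logb 2 (D (g ω, h ω)) - (Real.logb 2 (A (f ω, g ω, h ω))
        + Real.logb 2 (B (h ω))) := by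
      simp only [F]
      rw [Real.logb_div (by positivity) (by positivity), Real.logb_mul hCp.ne' hDp.ne',
        Real.logb_mul hAp.ne' hBp.ne']
    have h3 := mul_le_mul_of_nonneg_left h1 h0.le
    rw [h2] at h3
    calc _ = p ω * (Real.logb 2 (C (f ω, h ω))
        + Real.logb 2 (D (g ω, h ω)) - (Real.logb 2 (A (f ω, g ω, h ω))
        + Real.logb 2 (B (h ω)))) := by ring
      _ ≤ _ := h3
      _ = _ := by ring
  have hF : ∑ ω, p ω * F (f ω, g ω, h ω) ≤ ∑ ω, p ω := by
    rw [← sum_law_mul p (fun ω => (f ω, g ω, h ω)) F, ← hA]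
    calc ∑ x, A x * F x ≤ ∑ x : α × β × γ, C (x.1, x.2.2) * D x.2 / B x.2.2 := by
          refine Finset.sum_le_sum fun x _ => ?_
          rcases (A0 x).eq_or_lt with h0 | h0
          · rw [← h0, zero_mul]
            exact div_nonneg (mul_nonneg (C0 _) (D0 _)) (B0 _)
          · simp only [F]
            rw [← div_div, mul_div_assoc', mul_div_cancel₀ _ h0.ne']
      _ = ∑ c, (∑ a, C (a, c)) * (∑ b, D (b, c)) / B c := by
          simp_rw [Fintype.sum_prod_type]
          simp_rw [Finset.sum_mul_sum, Finset.sum_div]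
          conv_rhs => rw [Finset.sum_comm]
          refine Finset.sum_congr rfl fun a _ => ?_
          rw [Finset.sum_comm]
      _ = ∑ c, B c * B c / B c := by simp_rw [hC, hD, hB, sum_law_fst]
      _ = ∑ c, B c := by simp_rw [mul_self_div_self]
      _ = ∑ ω, p ω := sum_law _ _
  have hsum := Finset.sum_le_sum fun ω (_ : ω ∈ Finset.univ) => key ω
  rw [← Finset.sum_div, Finset.sum_sub_distrib, Finset.sum_sub_distrib, Finset.sum_sub_distrib,
    Finset.sum_add_distrib] at hsum
  have : (∑ ω, p ω * F (f ω, g ω, h ω) - ∑ ω, p ω) / Real.log 2 ≤ 0 :=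
    div_nonpos_of_nonpos_of_nonneg (by linarith) hl.le
  simp only [entropy_eq_sum]
  linarith

/-- Conditioning on more reduces entropy. -/
theorem condEntropy_le_condEntropy_comp {p : Ω → ℝ} (hp : ∀ ω, 0 ≤ p ω) (f : Ω → α) (k : Ω → β)
    (ψ : β → γ) : condEntropy p f k ≤ condEntropy p f (fun ω => ψ (k ω)) := by
  have h := entropy_submodular hp f k (fun ω => ψ (k ω))
  have h1 : entropy p (fun ω => (f ω, k ω, ψ (k ω))) = entropy p (fun ω => (f ω, k ω)) :=
    entropy_comp_of_injective p (fun ω => (f ω, k ω)) (e := fun x => (x.1, x.2, ψ x.2))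
      (by rintro ⟨a, b⟩ ⟨c, d⟩ h; simp at h; simp [h.1, h.2.1])
  have h2 : entropy p (fun ω => (k ω, ψ (k ω))) = entropy p k :=
    entropy_comp_of_injective p k (e := fun x => (x, ψ x))
      (by intro a b h; exact (Prod.mk.inj h).1)
  rw [h1, h2] at h
  unfold condEntropy
  linarith

theorem entropy_le_entropy_prod {p : Ω → ℝ} (hp : ∀ ω, 0 ≤ p ω) (f : Ω → α) (g : Ω → β) :
    entropy p g ≤ entropy p (fun ω => (f ω, g ω)) := by
  rw [entropy_eq_sum, entropy_eq_sum, neg_le_neg_iff]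
  refine Finset.sum_le_sum fun ω _ => ?_
  rcases (hp ω).eq_or_lt with h0 | h0
  · simp [← h0]
  refine mul_le_mul_of_nonneg_left ?_ h0.le
  refine Real.logb_le_logb_of_le one_lt_two
    (h0.trans_le (le_law_apply hp (fun ω => (f ω, g ω)) ω)) ?_
  rw [← sum_law_fst p f g]
  exact Finset.single_le_sum (f := fun a => law p (fun ω => (f ω, g ω)) (a, g ω))
    (fun a _ => law_nonneg hp _ _) (Finset.mem_univ _)

theorem entropy_prod_le {p : Ω → ℝ} (hp : ∀ ω, 0 ≤ p ω) (h1 : ∑ ω, p ω = 1) (f : Ω → α)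
    (g : Ω → β) : entropy p (fun ω => (f ω, g ω)) ≤ entropy p f + entropy p g := by
  -- Conditioning on a constant is no conditioning.
  have h := condEntropy_le_condEntropy_comp hp f g (fun _ => ())
  have h2 : entropy p (fun _ => ()) = 0 := by
    simp [entropy_eq_sum, law, h1]
  have h3 : entropy p (fun ω => (f ω, ())) = entropy p f :=
    entropy_comp_of_injective p f (e := fun x => (x, ()))
      (by intro a b h; exact (Prod.mk.inj h).1)
  unfold condEntropy at h
  linarith

/-- Chain rule for conditional entropy. -/
theorem sum_condEntropy_take {n : ℕ} (p : Ω → ℝ) (y : Ω → Fin n → α) (h : Ω → β) :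
    ∑ i : Fin n, condEntropy p (fun ω => y ω i) (fun ω => (Fin.take i i.is_le' (y ω), h ω))
      = condEntropy p y h := by
  induction n with
  | zero =>
    have : entropy p (fun ω => (y ω, h ω)) = entropy p h := by
      have e : (fun ω => (y ω, h ω)) = fun ω => ((default : Fin 0 → α), h ω) := by
        funext ω; rw [Subsingleton.elim (y ω)]
      rw [e]
      exact entropy_comp_of_injective p h (e := fun x => ((default : Fin 0 → α), x))
        (by intro a b h; exact (Prod.mk.inj h).2)
    simp [condEntropy, this]
  | succ n ih =>
    rw [Fin.sum_univ_castSucc]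
    have h1 := ih (fun ω => Fin.init (y ω))
    have h2 : ∑ i : Fin n, condEntropy p (fun ω => y ω i.castSucc)
        (fun ω => (Fin.take i.castSucc i.castSucc.is_le' (y ω), h ω))
        = condEntropy p (fun ω => Fin.init (y ω)) h := h1
    rw [h2]
    have h3 : entropy p (fun ω => (y ω (Fin.last n), (Fin.init (y ω), h ω)))
        = entropy p (fun ω => (y ω, h ω)) :=
      entropy_comp_of_injective p (fun ω => (y ω, h ω))
        (e := fun x : (Fin (n + 1) → α) × β => (x.1 (Fin.last n), ((Fin.init x.1 : Fin n → α), x.2)))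
        (by
          rintro ⟨a, b⟩ ⟨c, d⟩ h
          simp only [Prod.mk.injEq] at h
          rw [← Fin.snoc_init_self a, ← Fin.snoc_init_self c, h.1, h.2.1, h.2.2])
    change _ + condEntropy p (fun ω => y ω (Fin.last n)) (fun ω => (Fin.init (y ω), h ω)) = _
    unfold condEntropy
    rw [h3]
    ring

theorem massEntropy_nonneg {p : Ω → ℝ} (hp : ∀ ω, 0 ≤ p ω) (h1 : ∑ ω, p ω = 1) :
    0 ≤ massEntropy p := by
  rw [massEntropy, ← Finset.sum_neg_distrib]
  refine Finset.sum_nonneg fun ω _ => ?_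
  have : p ω ≤ 1 := h1 ▸ Finset.single_le_sum (fun i _ => hp i) (Finset.mem_univ ω)
  have := Real.logb_nonpos one_lt_two (hp ω) this
  nlinarith [hp ω]

theorem massEntropy_prod {p : α → ℝ} {r : β → ℝ} (hp : ∑ a, p a = 1) (hr : ∑ b, r b = 1) :
    massEntropy (fun x : α × β => p x.1 * r x.2) = massEntropy p + massEntropy r := by
  have key : ∀ a b, p a * r b * Real.logb 2 (p a * r b)
      = p a * Real.logb 2 (p a) * r b + p a * (r b * Real.logb 2 (r b)) := by
    intro a b
    by_cases ha : p a = 0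
    · simp [ha]
    by_cases hb : r b = 0
    · simp [hb]
    rw [Real.logb_mul ha hb]
    ring
  simp only [massEntropy, Fintype.sum_prod_type, key, Finset.sum_add_distrib, ← Finset.mul_sum, hr,
    ← Finset.sum_mul, hp]
  ring

end FiniteInfo

/-! ### Feinstein's bound and the information density -/

namespace FiniteInfo

variable {α β : Type*} [Fintype α] [Fintype β]

/-- Derandomises the choice of each new codeword. -/
theorem exists_le_of_weighted_sum_le {P : α → ℝ} (hP : ∀ a, 0 ≤ P a) (hP1 : ∑ a, P a = 1)
    {F : α → ℝ} {B : ℝ} (h : ∑ a, P a * F a ≤ B) : ∃ a, F a ≤ B := by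
  by_contra! hc
  have h1 : ∑ a, P a * B < ∑ a, P a * F a := by
    obtain ⟨a, -, ha⟩ : ∃ a ∈ Finset.univ, P a ≠ 0 := by
      refine Finset.exists_ne_zero_of_sum_ne_zero (f := P) ?_
      rw [hP1]; exact one_ne_zero
    refine Finset.sum_lt_sum (fun a _ => mul_le_mul_of_nonneg_left (hc a).le (hP a))
      ⟨a, Finset.mem_univ _, mul_lt_mul_of_pos_left (hc a) ((hP a).lt_of_ne' ha)⟩
  rw [← Finset.sum_mul, hP1, one_mul] at h1
  exact absurd h (not_le.mpr h1)

open Classical in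
/-- Greedy choice of codewords for sequential threshold decoding. -/
theorem exists_codewords {P : α → ℝ} (hP : ∀ a, 0 ≤ P a) (hP1 : ∑ a, P a = 1)
    (W : α → β → ℝ) (T : α → β → Prop) {κ : ℝ}
    (hT : ∀ a, ∑ b, (if T a b then ∑ a', P a' * W a' b else 0) ≤ κ) (M : ℕ) :
    ∃ c : Fin M → α, ∀ w : Fin M,
      ∑ b, W (c w) b * ((if T (c w) b then 0 else 1) + ∑ w' : Fin M,
        if w' < w ∧ T (c w') b then 1 else 0)
      ≤ ∑ a, ∑ b, P a * W a b * (if T a b then 0 else 1) + w * κ := by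
  induction M with
  | zero => exact ⟨Fin.elim0, fun w => w.elim0⟩
  | succ M ih =>
    obtain ⟨c, hc⟩ := ih
    -- Under a random new codeword the output has the mixture law, so by `hT` each earlier codeword
    -- captures it with probability at most κ.
    obtain ⟨a, ha⟩ := exists_le_of_weighted_sum_le hP hP1
      (F := fun a => ∑ b, W a b * ((if T a b then 0 else 1) + ∑ w' : Fin M,
        if T (c w') b then 1 else 0))
      (B := ∑ a, ∑ b, P a * W a b * (if T a b then 0 else 1) + M * κ) (by
        have e : ∑ a, P a * ∑ b, W a b * ((if T a b then 0 else 1) + ∑ w' : Fin M,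
            if T (c w') b then 1 else 0)
            = ∑ a, ∑ b, P a * W a b * (if T a b then 0 else 1)
              + ∑ w' : Fin M, ∑ b, (if T (c w') b then ∑ a', P a' * W a' b else 0) := by
          have e1 : ∑ w' : Fin M, ∑ b, (if T (c w') b then ∑ a', P a' * W a' b else 0)
              = ∑ a, ∑ b, ∑ w' : Fin M, P a * W a b * (if T (c w') b then 1 else 0) := by
            have : ∀ w' : Fin M, ∑ b, (if T (c w') b then ∑ a', P a' * W a' b else 0)
                = ∑ a, ∑ b, P a * W a b * (if T (c w') b then 1 else 0) := by
              intro w'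
              rw [Finset.sum_comm]
              refine Finset.sum_congr rfl fun b _ => ?_
              split_ifs <;> simp
            simp_rw [this]
            rw [Finset.sum_comm]
            refine Finset.sum_congr rfl fun a _ => ?_
            rw [Finset.sum_comm]
          rw [e1, ← Finset.sum_add_distrib]
          refine Finset.sum_congr rfl fun a _ => ?_
          rw [Finset.mul_sum, ← Finset.sum_add_distrib]
          refine Finset.sum_congr rfl fun b _ => ?_
          rw [← Finset.mul_sum]
          ring
        rw [e]
        gcongr
        calc _ ≤ ∑ w' : Fin M, κ := Finset.sum_le_sum fun w' _ => hT (c w')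
          _ = M * κ := by simp)
    -- The bound for w involves only codewords of smaller index, so appending at the end leaves the
    -- earlier bounds intact.
    refine ⟨Fin.snoc c a, fun w => ?_⟩
    induction w using Fin.lastCases with
    | last => simpa [Fin.sum_univ_castSucc, -Finset.sum_boole] using ha
    | cast w =>
      have := hc w
      have h2 : ¬ Fin.last M < w.castSucc := by
        simpa using (Fin.le_last _)
      simpa [Fin.sum_univ_castSucc, h2, -Finset.sum_boole] using this

open Classical in
/-- Feinstein's bound: a code with `M` codewords for the finite channel `W`. -/
theorem exists_code {P : α → ℝ} (hP : ∀ a, 0 ≤ P a) (hP1 : ∑ a, P a = 1)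
    {W : α → β → ℝ} (hW : ∀ a b, 0 ≤ W a b) (T : α → β → Prop) {κ : ℝ} (hκ : 0 ≤ κ)
    (hT : ∀ a, ∑ b, (if T a b then ∑ a', P a' * W a' b else 0) ≤ κ) (M : ℕ) (hM : 0 < M) :
    ∃ (c : Fin M → α) (d : β → Fin M),
      (∑ w : Fin M, ∑ b with d b ≠ w, W (c w) b) / M
        ≤ ∑ a, ∑ b, P a * W a b * (if T a b then 0 else 1) + (M - 1 : ℝ) * κ := by
  obtain ⟨c, hc⟩ := exists_codewords hP hP1 W T hT M
  -- The decoder takes the least index passing the threshold test, and index 0 if none passes.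
  have hd : ∀ b, ∃ w : Fin M, ∀ w₀, T (c w₀) b → T (c w) b ∧ w ≤ w₀ := by
    intro b
    by_cases h : ∃ w, T (c w) b
    · obtain ⟨w, hw, hmin⟩ := WellFounded.has_min (wellFounded_lt (α := Fin M))
        {w | T (c w) b} h
      exact ⟨w, fun w₀ h₀ => ⟨hw, not_lt.mp (hmin w₀ h₀)⟩⟩
    · push Not at h
      exact ⟨⟨0, hM⟩, fun w₀ h₀ => absurd h₀ (h w₀)⟩
  choose d hd using hd
  refine ⟨c, d, ?_⟩
  have hM' : (0 : ℝ) < M := by exact_mod_cast hM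
  rw [div_le_iff₀ hM']
  calc ∑ w : Fin M, ∑ b with d b ≠ w, W (c w) b
      ≤ ∑ w : Fin M, (∑ a, ∑ b, P a * W a b * (if T a b then 0 else 1) + (M - 1 : ℝ) * κ) := by
        refine Finset.sum_le_sum fun w _ => ?_
        have hw : (w : ℝ) ≤ M - 1 := by
          have := w.2
          have : (w : ℝ) + 1 ≤ M := by exact_mod_cast this
          linarith
        refine le_trans ?_ ((hc w).trans (by gcongr))
        rw [Finset.sum_filter]
        refine Finset.sum_le_sum fun b _ => ?_
        have h0 : (0 : ℝ) ≤ ∑ w' : Fin M, if w' < w ∧ T (c w') b then 1 else 0 :=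
          Finset.sum_nonneg fun _ _ => by split_ifs <;> norm_num
        split_ifs with h1 h2 h2
        -- The codeword w passes but is not chosen, so a smaller index passes and the sum over w' is
        -- at least 1.
        · obtain ⟨h3, h4⟩ := hd b w h2
          have h5 : (1 : ℝ) ≤ ∑ w' : Fin M, if w' < w ∧ T (c w') b then 1 else 0 := by
            refine le_trans ?_ (Finset.single_le_sum
              (f := fun w' : Fin M => if w' < w ∧ T (c w') b then (1 : ℝ) else 0)
              (fun _ _ => by split_ifs <;> norm_num) (Finset.mem_univ (d b)))
            simp [lt_of_le_of_ne h4 h1, h3]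
          nlinarith [hW (c w) b]
        · nlinarith [hW (c w) b]
        · exact mul_nonneg (hW _ _) (by linarith)
        · exact mul_nonneg (hW _ _) (by linarith)
    _ = _ := by
        simp only [Finset.sum_const, Finset.card_univ, Fintype.card_fin, nsmul_eq_mul]
        ring

/-- Mutual information of input and output of a finite channel as an expected information
density. -/
theorem mutualInfo_eq_sum {P : α → ℝ} (hP : ∀ a, 0 ≤ P a)
    {W : α → β → ℝ} (hW : ∀ a b, 0 ≤ W a b) (hW1 : ∀ a, ∑ b, W a b = 1) :
    massEntropy P + massEntropy (fun b => ∑ a, P a * W a b)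
        - massEntropy (fun x : α × β => P x.1 * W x.1 x.2)
      = ∑ a, ∑ b, P a * W a b * Real.logb 2 (W a b / ∑ a', P a' * W a' b) := by
  set Q : β → ℝ := fun b => ∑ a, P a * W a b with hQ
  have key : ∀ a b, P a * W a b * Real.logb 2 (W a b / Q b)
      = P a * W a b * Real.logb 2 (P a * W a b) - P a * Real.logb 2 (P a) * W a b
        - P a * W a b * Real.logb 2 (Q b) := by
    intro a b
    by_cases ha : P a = 0
    · simp [ha]
    by_cases hb : W a b = 0
    · simp [hb]
    have hq : Q b ≠ 0 := by
      have h1 : P a * W a b ≤ Q b :=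
        Finset.single_le_sum (f := fun a => P a * W a b)
          (fun a _ => mul_nonneg (hP a) (hW a b)) (Finset.mem_univ a)
      have h2 : 0 < P a * W a b :=
        mul_pos ((hP a).lt_of_ne' ha) ((hW a b).lt_of_ne' hb)
      exact (h2.trans_le h1).ne'
    rw [Real.logb_div hb hq, Real.logb_mul ha hb]
    ring
  have e3 : ∑ a, ∑ b, P a * W a b * Real.logb 2 (Q b) = ∑ b, Q b * Real.logb 2 (Q b) := by
    rw [Finset.sum_comm]
    simp_rw [← Finset.sum_mul]
    rfl
  have e2 : ∑ a, ∑ b, P a * Real.logb 2 (P a) * W a b = ∑ a, P a * Real.logb 2 (P a) := by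
    simp_rw [← Finset.mul_sum, hW1, mul_one]
  change _ = ∑ a, ∑ b, P a * W a b * Real.logb 2 (W a b / Q b)
  simp only [key, Finset.sum_sub_distrib, e2, e3]
  simp only [massEntropy, Fintype.sum_prod_type]
  ring

open Classical in
/-- If the mutual information exceeds `γ`, the information density exceeds `γ` with a probability
bounded below in terms of the size of the output alphabet. -/
theorem mutualInfo_le {P : α → ℝ} (hP : ∀ a, 0 ≤ P a) (hP1 : ∑ a, P a = 1)
    {W : α → β → ℝ} (hW : ∀ a b, 0 ≤ W a b) (hW1 : ∀ a, ∑ b, W a b = 1) (γ : ℝ) {t : ℝ}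
    (ht : t = ∑ a, ∑ b, P a * W a b *
      (if 2 ^ γ * ∑ a', P a' * W a' b < W a b then 1 else 0)) :
    massEntropy P + massEntropy (fun b => ∑ a, P a * W a b)
        - massEntropy (fun x : α × β => P x.1 * W x.1 x.2)
      ≤ γ * (1 - t) + t * Real.logb 2 (Fintype.card β) + 1 / Real.log 2 := by
  rw [mutualInfo_eq_sum hP hW hW1]
  set Q : β → ℝ := fun b => ∑ a, P a * W a b with hQ
  have hl := Real.log_pos (one_lt_two)
  set N : ℝ := (Fintype.card β : ℝ) with hN
  have hJ1 : ∑ a, ∑ b, P a * W a b = 1 := by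
    simp_rw [← Finset.mul_sum, hW1, mul_one, hP1]
  -- Below the threshold the density is at most γ. Above it, W ≤ 1 gives log (W/Q) ≤ log N + log
  -- (1/(NQ)), and the last logarithm is at most 1/(NQ log 2) up to a negative constant; the mean of
  -- this bound is at most 1/log 2, since Q cancels.
  have key : ∀ a b, P a * W a b * Real.logb 2 (W a b / Q b) ≤
      γ * (P a * W a b) - γ * (P a * W a b * (if 2 ^ γ * Q b < W a b then 1 else 0))
      + (P a * W a b * (if 2 ^ γ * Q b < W a b then 1 else 0)) * Real.logb 2 N
      + P a * W a b * (1 / (N * Q b) / Real.log 2) := by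
    intro a b
    rcases (hP a).eq_or_lt with ha | ha
    · simp [← ha]
    rcases (hW a b).eq_or_lt with hb | hb
    · simp [← hb]
    have hJ : 0 < P a * W a b := mul_pos ha hb
    have hq : 0 < Q b := hJ.trans_le <|
      Finset.single_le_sum (f := fun a => P a * W a b)
        (fun a _ => mul_nonneg (hP a) (hW a b)) (Finset.mem_univ a)
    have hNp : 0 < N := by
      have : Nonempty β := ⟨b⟩
      exact Nat.cast_pos.mpr Fintype.card_pos
    have hW1' : W a b ≤ 1 := hW1 a ▸ Finset.single_le_sum (fun b _ => hW a b) (Finset.mem_univ b)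
    have hpos : 0 ≤ 1 / (N * Q b) / Real.log 2 := by positivity
    split_ifs with h
    · have h1 : Real.logb 2 (W a b / Q b) ≤ Real.logb 2 N + 1 / (N * Q b) / Real.log 2 := by
        calc Real.logb 2 (W a b / Q b) ≤ Real.logb 2 (N * (1 / (N * Q b))) := by
              refine Real.logb_le_logb_of_le one_lt_two (by positivity) ?_
              rw [mul_one_div, div_mul_cancel_left₀ hNp.ne', div_eq_mul_inv]
              exact mul_le_of_le_one_left (by positivity) hW1'
          _ = Real.logb 2 N + Real.logb 2 (1 / (N * Q b)) :=
              Real.logb_mul hNp.ne' (by positivity)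
          _ ≤ _ := by
              gcongr
              refine (logb_two_le (by positivity)).trans ?_
              gcongr
              linarith
      have := mul_le_mul_of_nonneg_left h1 hJ.le
      linarith
    · have h1 : Real.logb 2 (W a b / Q b) ≤ γ := by
        rw [Real.logb_le_iff_le_rpow one_lt_two (by positivity), div_le_iff₀ hq]
        exact not_lt.mp h
      have := mul_le_mul_of_nonneg_left h1 hJ.le
      have := mul_nonneg hJ.le hpos
      linarith
  have hlast : ∑ a, ∑ b, P a * W a b * (1 / (N * Q b) / Real.log 2) ≤ 1 / Real.log 2 := by
    rw [Finset.sum_comm]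
    simp_rw [← Finset.sum_mul]
    calc ∑ b, Q b * (1 / (N * Q b) / Real.log 2) ≤ ∑ b : β, 1 / N / Real.log 2 := by
          refine Finset.sum_le_sum fun b _ => ?_
          by_cases hq : Q b = 0
          · rw [hq, zero_mul]; positivity
          · apply le_of_eq
            field_simp
      _ ≤ 1 / Real.log 2 := by
          rw [Finset.sum_const, Finset.card_univ, nsmul_eq_mul, ← hN, mul_div_assoc', mul_one_div]
          gcongr
          exact div_self_le_one N
  have hs := Finset.sum_le_sum fun a (_ : a ∈ Finset.univ) =>
    Finset.sum_le_sum fun b (_ : b ∈ Finset.univ) => key a b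
  refine hs.trans ?_
  simp only [Finset.sum_add_distrib, Finset.sum_sub_distrib, ← Finset.mul_sum _ _ γ, ← Finset.sum_mul,
    hJ1]
  rw [ht]
  simp only [hQ] at hlast ⊢
  linarith

end FiniteInfo

/-! ### Causal kernels and random strategies -/

theorem PMF.sum_toReal {α : Type*} [Fintype α] (p : PMF α) : ∑ a, (p a).toReal = 1 := by
  rw [← ENNReal.toReal_sum fun a _ => p.apply_ne_top a, ← tsum_fintype (L := .unconditional _),
    p.tsum_coe, ENNReal.toReal_one]

theorem sum_prod_kernel {α : Type*} [Fintype α] {n : ℕ} (κ : (i : Fin n) → (Fin i → α) → PMF α) :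
    ∑ y : Fin n → α, ∏ i : Fin n, (κ i (Fin.take i i.is_le' y) (y i)).toReal = 1 := by
  induction n with
  | zero => simp
  | succ n ih =>
    rw [← (Fin.snocEquiv fun _ : Fin (n + 1) => α).sum_comp, Fintype.sum_prod_type,
      Finset.sum_comm]
    have h : ∀ (y : Fin n → α) (a : α),
        ∏ i : Fin (n + 1), (κ i (Fin.take i i.is_le' (Fin.snoc (α := fun _ => α) y a))
          (Fin.snoc (α := fun _ => α) y a i)).toReal
        = (∏ i : Fin n, (κ i.castSucc (Fin.take i i.is_le' y) (y i)).toReal)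
          * (κ (Fin.last n) y a).toReal := by
      intro y a
      have h1 : ∀ i : Fin n, Fin.take i.castSucc i.castSucc.is_le'
          (Fin.snoc (α := fun _ => α) y a) = Fin.take i i.is_le' y := by
        intro i
        funext j
        exact Fin.snoc_castSucc (α := fun _ => α) a y ⟨j, j.2.trans i.2⟩
      have h2 : Fin.take (Fin.last n) (Fin.last n).is_le' (Fin.snoc (α := fun _ => α) y a) = y := by
        funext j
        exact Fin.snoc_castSucc (α := fun _ => α) a y j
      rw [Fin.prod_univ_castSucc]
      simp only [h1, h2, Fin.snoc_castSucc, Fin.snoc_last]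
    calc _ = ∑ y : Fin n → α, ∑ a : α,
        (∏ i : Fin n, (κ i.castSucc (Fin.take i i.is_le' y) (y i)).toReal)
          * (κ (Fin.last n) y a).toReal :=
          Finset.sum_congr rfl fun y _ => Finset.sum_congr rfl fun a _ => h y a
      _ = 1 := by
          simp_rw [← Finset.mul_sum, PMF.sum_toReal, mul_one]
          exact ih fun i => κ i.castSucc

/-- A choice of the next input for each time and each past of inputs and feedback. -/
abbrev Strategy (X Z : Type*) (n : ℕ) : Type _ :=
  ((i : Fin n) × ((Fin i → X) × (Fin i → Z))) → X

namespace Strategy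

variable {X Z : Type*} {n : ℕ}

/-- The code-function that follows a strategy. -/
def code (g : Strategy X Z n) (i : Fin n) (z : Fin i → Z) : X :=
  g ⟨i, fun j => code g ⟨j, j.2.trans i.2⟩ (Fin.take j j.is_le' z), z⟩
termination_by i.1
decreasing_by exact j.2

theorem codeInput_code_apply (g : Strategy X Z n) (z : Fin n → Z) (i : Fin n) :
    codeInput g.code z i
      = g ⟨i, Fin.take i i.is_le' (codeInput g.code z), Fin.take i i.is_le' z⟩ := by
  rw [codeInput, code]
  rfl

/-- Turns the recursive event into one constraint per time on distinct coordinates of g, which are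
independent under `mass`. -/
theorem codeInput_code_eq_iff (g : Strategy X Z n) (z : Fin n → Z) (x : Fin n → X) :
    codeInput g.code z = x
      ↔ ∀ i : Fin n, g ⟨i, Fin.take i i.is_le' x, Fin.take i i.is_le' z⟩ = x i := by
  constructor
  · rintro rfl i
    exact (codeInput_code_apply g z i).symm
  · intro h
    have key : ∀ (m : ℕ) (hm : m < n), codeInput g.code z ⟨m, hm⟩ = x ⟨m, hm⟩ := by
      intro m
      induction m using Nat.strong_induction_on with
      | _ m ih =>
        intro hm
        have e : Fin.take m hm.le (codeInput g.code z) = Fin.take m hm.le x := by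
          funext j
          exact ih j j.2 (j.2.trans hm)
        rw [codeInput_code_apply, ← h ⟨m, hm⟩]
        exact congrArg g (Sigma.ext rfl (heq_of_eq (Prod.ext e rfl)))
    funext i
    exact key i i.2

/-- The law of a random strategy whose choices are independent and distributed according to `q`. -/
def mass [Fintype X] [Fintype Z] (q : InputDistribution X Z) (g : Strategy X Z n) : ℝ :=
  ∏ c : (i : Fin n) × ((Fin i → X) × (Fin i → Z)), (q c.1 c.2.1 c.2.2 (g c)).toReal

variable [Fintype X] [Fintype Z]

theorem mass_nonneg (q : InputDistribution X Z) (g : Strategy X Z n) : 0 ≤ mass q g :=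
  Finset.prod_nonneg fun _ _ => ENNReal.toReal_nonneg

variable [DecidableEq X] [DecidableEq Z]

theorem sum_mass (q : InputDistribution X Z) : ∑ g : Strategy X Z n, mass q g = 1 := by
  have h := Finset.prod_univ_sum
    (fun _ : (i : Fin n) × ((Fin i → X) × (Fin i → Z)) => (Finset.univ : Finset X))
    (fun c a => (q c.1 c.2.1 c.2.2 a).toReal)
  rw [Fintype.piFinset_univ] at h
  refine h.symm.trans ?_
  simp_rw [PMF.sum_toReal, Finset.prod_const_one]

/-- Following a random strategy reproduces the input distribution. -/
theorem sum_mass_of_codeInput_eq (q : InputDistribution X Z) (x : Fin n → X) (z : Fin n → Z) :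
    ∑ g : Strategy X Z n, (if codeInput g.code z = x then mass q g else 0) = inputMass q n x z := by
  -- Only the coordinates along the path (x, z) are constrained; each of them contributes one factor
  -- of `inputMass`, and every other coordinate sums to 1.
  have h := Finset.prod_univ_sum
    (fun _ : (i : Fin n) × ((Fin i → X) × (Fin i → Z)) => (Finset.univ : Finset X))
    (fun c a => if c.2 = (Fin.take c.1 c.1.is_le' x, Fin.take c.1 c.1.is_le' z) → a = x c.1
      then (q c.1 c.2.1 c.2.2 a).toReal else 0)
  rw [Fintype.piFinset_univ] at h
  have h1 : ∀ g : Strategy X Z n, (if codeInput g.code z = x then mass q g else 0)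
      = ∏ c : (i : Fin n) × ((Fin i → X) × (Fin i → Z)),
        if c.2 = (Fin.take c.1 c.1.is_le' x, Fin.take c.1 c.1.is_le' z) → g c = x c.1
          then (q c.1 c.2.1 c.2.2 (g c)).toReal else 0 := by
    intro g
    by_cases hg : codeInput g.code z = x
    · rw [if_pos hg]
      rw [codeInput_code_eq_iff] at hg
      refine Finset.prod_congr rfl fun c _ => ?_
      rw [if_pos]
      obtain ⟨i, c⟩ := c
      intro hc
      dsimp only at hc
      rw [hc]
      exact hg i
    · rw [if_neg hg]
      rw [codeInput_code_eq_iff] at hg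
      push Not at hg
      obtain ⟨i, hi⟩ := hg
      refine (Finset.prod_eq_zero (Finset.mem_univ
        ⟨i, Fin.take i i.is_le' x, Fin.take i i.is_le' z⟩) ?_).symm
      rw [if_neg]
      simpa using hi
  simp_rw [h1]
  rw [← h, Fintype.prod_sigma]
  refine Finset.prod_congr rfl fun i _ => ?_
  rw [Finset.prod_eq_single (Fin.take i i.is_le' x, Fin.take i i.is_le' z)]
  · simp
  · intro c _ hc
    simp [hc, PMF.sum_toReal]
  · simp

end Strategy

/-! ### Joint law of strategy, output and noise -/

namespace AdditiveNoiseFeedbackChannel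

open FiniteInfo

variable {X A : Type*} [AddCommGroup A] [DecidableEq A] {Y V : Finset A}

theorem noiseMass_nonneg (K : AdditiveNoiseFeedbackChannel X Y V) {n : ℕ} (v : Fin n → V) :
    0 ≤ K.noiseMass n v :=
  Finset.prod_nonneg fun _ _ => ENNReal.toReal_nonneg

theorem sum_noiseMass (K : AdditiveNoiseFeedbackChannel X Y V) (n : ℕ) :
    ∑ v : Fin n → V, K.noiseMass n v = 1 :=
  sum_prod_kernel fun i => K.noise i

theorem forwardMass_nonneg (K : AdditiveNoiseFeedbackChannel X Y V) {n : ℕ} (x : Fin n → X)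
    (y : Fin n → Y) : 0 ≤ K.forwardMass n x y :=
  Finset.prod_nonneg fun _ _ => ENNReal.toReal_nonneg

/-- For fixed noise, feedback and inputs are causal functions of the outputs, so the forward laws
form a causal kernel in y alone. -/
theorem sum_forwardMass (K : AdditiveNoiseFeedbackChannel X Y V) {n : ℕ}
    (f : (i : Fin n) → (Fin i → ↥(Y + V)) → X) (v : Fin n → V) :
    ∑ y : Fin n → Y, K.forwardMass n (codeInput f (feedback y v)) y = 1 :=
  sum_prod_kernel fun i y => K.forward i
    (fun j : Fin (i + 1) => f (Fin.castLE i.2 j) (feedback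
      (Fin.take j (Nat.lt_succ_iff.mp j.2) y) (Fin.take j (Fin.castLE i.2 j).is_le' v))) y

theorem outputMass_nonneg (K : AdditiveNoiseFeedbackChannel X Y V) {n : ℕ}
    (f : (i : Fin n) → (Fin i → ↥(Y + V)) → X) (y : Fin n → Y) : 0 ≤ K.outputMass f y :=
  Finset.sum_nonneg fun _ _ => mul_nonneg (K.noiseMass_nonneg _) (K.forwardMass_nonneg _ _)

theorem sum_outputMass (K : AdditiveNoiseFeedbackChannel X Y V) {n : ℕ}
    (f : (i : Fin n) → (Fin i → ↥(Y + V)) → X) : ∑ y, K.outputMass f y = 1 := by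
  unfold outputMass
  rw [Finset.sum_comm]
  simp_rw [← Finset.mul_sum, sum_forwardMass, mul_one, sum_noiseMass]

variable [Fintype X] [DecidableEq X]

/-- The joint mass function of strategy, output and noise. -/
def strategyMass (K : AdditiveNoiseFeedbackChannel X Y V) (q : InputDistribution X ↥(Y + V))
    (n : ℕ) : Strategy X ↥(Y + V) n × (Fin n → Y) × (Fin n → V) → ℝ :=
  fun ω => Strategy.mass q ω.1 * (K.noiseMass n ω.2.2
    * K.forwardMass n (codeInput ω.1.code (feedback ω.2.1 ω.2.2)) ω.2.1)

theorem strategyMass_nonneg (K : AdditiveNoiseFeedbackChannel X Y V)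
    (q : InputDistribution X ↥(Y + V)) (n : ℕ)
    (ω : Strategy X ↥(Y + V) n × (Fin n → Y) × (Fin n → V)) : 0 ≤ K.strategyMass q n ω :=
  mul_nonneg (Strategy.mass_nonneg _ _)
    (mul_nonneg (K.noiseMass_nonneg _) (K.forwardMass_nonneg _ _))

theorem law_strategyMass (K : AdditiveNoiseFeedbackChannel X Y V)
    (q : InputDistribution X ↥(Y + V)) (n : ℕ) :
    law (K.strategyMass q n) (fun ω => (codeInput ω.1.code (feedback ω.2.1 ω.2.2), ω.2.1, ω.2.2))
      = K.jointMass q n := by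
  funext ⟨x, y, v⟩
  rw [law_eq_sum_ite]
  simp only [Fintype.sum_prod_type, Prod.mk.injEq, strategyMass, jointMass]
  rw [← Strategy.sum_mass_of_codeInput_eq, Finset.mul_sum, Finset.sum_mul]
  refine Finset.sum_congr rfl fun g _ => ?_
  rw [Finset.sum_eq_single y, Finset.sum_eq_single v]
  · by_cases h : codeInput g.code (feedback y v) = x
    · simp only [h, and_self, if_true]
      ring
    · simp [h]
  · intro v' _ hv
    simp [hv]
  · simp
  · intro y' _ hy
    simp [hy]
  · simp

theorem law_strategyMass_strategy_output (K : AdditiveNoiseFeedbackChannel X Y V)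
    (q : InputDistribution X ↥(Y + V)) (n : ℕ) :
    law (K.strategyMass q n) (fun ω => (ω.1, ω.2.1))
      = fun x => Strategy.mass q x.1 * K.outputMass x.1.code x.2 := by
  funext ⟨g, y⟩
  rw [law_eq_sum_ite]
  simp only [Fintype.sum_prod_type, Prod.mk.injEq, strategyMass, outputMass]
  rw [Finset.sum_eq_single g, Finset.sum_eq_single y, Finset.mul_sum]
  · simp
  · intro y' _ hy
    simp [hy]
  · simp
  · intro g' _ hg
    simp [hg]
  · simp

/-- Strategy and noise are independent: the forward laws sum to 1 for each fixed pair of them. -/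
theorem law_strategyMass_noise_strategy (K : AdditiveNoiseFeedbackChannel X Y V)
    (q : InputDistribution X ↥(Y + V)) (n : ℕ) :
    law (K.strategyMass q n) (fun ω => (ω.2.2, ω.1))
      = fun x => K.noiseMass n x.1 * Strategy.mass q x.2 := by
  funext ⟨v, g⟩
  rw [law_eq_sum_ite]
  simp only [Fintype.sum_prod_type, Prod.mk.injEq, strategyMass]
  rw [Finset.sum_eq_single g, Finset.sum_comm, Finset.sum_eq_single v]
  · simp only [and_self, if_true, ← Finset.mul_sum, sum_forwardMass]
    ring
  · intro v' _ hv
    simp [hv]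
  · simp
  · intro g' _ hg
    simp [hg]
  · simp

theorem law_strategyMass_output (K : AdditiveNoiseFeedbackChannel X Y V)
    (q : InputDistribution X ↥(Y + V)) (n : ℕ) :
    law (K.strategyMass q n) (fun ω => ω.2.1)
      = fun y => ∑ g : Strategy X ↥(Y + V) n, Strategy.mass q g * K.outputMass g.code y := by
  funext y
  rw [← sum_law_fst _ (fun ω => ω.1), law_strategyMass_strategy_output]

theorem law_strategyMass_noise (K : AdditiveNoiseFeedbackChannel X Y V)
    (q : InputDistribution X ↥(Y + V)) (n : ℕ) :
    law (K.strategyMass q n) (fun ω => ω.2.2) = K.noiseMass n := by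
  have h := law_law (K.strategyMass q n) (fun ω => (ω.2.2, ω.1)) Prod.fst
  rw [← h, law_strategyMass_noise_strategy]
  funext v
  rw [law_eq_sum_ite, Fintype.sum_prod_type, Finset.sum_eq_single v]
  · simp [← Finset.mul_sum, Strategy.sum_mass]
  · intro v' _ hv
    simp [hv]
  · simp

theorem sum_strategyMass (K : AdditiveNoiseFeedbackChannel X Y V)
    (q : InputDistribution X ↥(Y + V)) (n : ℕ) : ∑ ω, K.strategyMass q n ω = 1 := by
  rw [← sum_law _ (fun ω => ω.2.2), law_strategyMass_noise, sum_noiseMass]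

/-- The conditional directed information exceeds the mutual information of strategy and output by
at most the entropy of the noise. -/
theorem condDirectedInfo_sub_le (K : AdditiveNoiseFeedbackChannel X Y V)
    (q : InputDistribution X ↥(Y + V)) (n : ℕ) :
    K.condDirectedInfo q n - massEntropy (K.noiseMass n)
      ≤ massEntropy (fun g : Strategy X ↥(Y + V) n => Strategy.mass q g)
        + massEntropy (fun y => ∑ g : Strategy X ↥(Y + V) n,
          Strategy.mass q g * K.outputMass g.code y)
        - massEntropy (fun x : Strategy X ↥(Y + V) n × (Fin n → Y) =>
          Strategy.mass q x.1 * K.outputMass x.1.code x.2) := by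
  set p := K.strategyMass q n with hp
  have p0 : ∀ ω, 0 ≤ p ω := K.strategyMass_nonneg q n
  -- Termwise after the chain rule: X^i is a function of (Y^{i-1}, V^n, G), so conditioning on the
  -- latter instead of (X^i, Y^{i-1}, V^n) can only lower the subtracted entropy.
  have hI : K.condDirectedInfo q n ≤ condEntropy p (fun ω => ω.2.1) (fun ω => ω.2.2)
      - condEntropy p (fun ω => ω.2.1) (fun ω => (ω.2.2, ω.1)) := by
    rw [← sum_condEntropy_take, ← sum_condEntropy_take, ← Finset.sum_sub_distrib]
    refine Finset.sum_le_sum fun i _ => ?_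
    rw [condMutualInfo, ← law_strategyMass, condEntropy_law, condEntropy_law]
    refine sub_le_sub_left ?_ _
    exact condEntropy_le_condEntropy_comp p0 (fun ω => ω.2.1 i)
      (fun ω => (Fin.take i i.is_le' ω.2.1, (ω.2.2, ω.1)))
      (fun k : (Fin i → Y) × (Fin n → V) × Strategy X ↥(Y + V) n =>
        ((fun j : Fin (i + 1) => k.2.2.code (Fin.castLE i.2 j) (feedback
          (Fin.take j (Nat.lt_succ_iff.mp j.2) k.1)
          (Fin.take j (Fin.castLE i.2 j).is_le' k.2.1))), (k.1, k.2.1)))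
  have hVG : entropy p (fun ω => (ω.2.2, ω.1)) = massEntropy (K.noiseMass n)
      + massEntropy (fun g : Strategy X ↥(Y + V) n => Strategy.mass q g) := by
    rw [entropy, law_strategyMass_noise_strategy]
    exact massEntropy_prod (K.sum_noiseMass n) (Strategy.sum_mass q)
  have hV : entropy p (fun ω => ω.2.2) = massEntropy (K.noiseMass n) := by
    rw [entropy, law_strategyMass_noise]
  have hYV := entropy_prod_le p0 (K.sum_strategyMass q n) (fun ω => ω.2.1) (fun ω => ω.2.2)
  have hGY : entropy p (fun ω => (ω.1, ω.2.1)) ≤ entropy p (fun ω => (ω.2.1, (ω.2.2, ω.1))) := by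
    have h1 := entropy_le_entropy_prod p0 (fun ω => ω.2.2) (fun ω => (ω.1, ω.2.1))
    have h2 := entropy_comp_of_injective p (fun ω => (ω.2.1, (ω.2.2, ω.1)))
      (e := fun x => (x.2.1, (x.2.2, x.1)))
      (by rintro ⟨a, b, c⟩ ⟨a', b', c'⟩ h; simp only [Prod.mk.injEq] at h ⊢; tauto)
    exact h1.trans h2.le
  rw [← law_strategyMass_output, ← law_strategyMass_strategy_output]
  change _ ≤ _ + entropy p (fun ω => ω.2.1) - entropy p (fun ω => (ω.1, ω.2.1))
  unfold condEntropy at hI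
  linarith

end AdditiveNoiseFeedbackChannel

/-! ### Codes against the strong converse -/

namespace AdditiveNoiseFeedbackChannel

open FiniteInfo Filter Topology

variable {X A : Type*} [AddCommGroup A] [DecidableEq A] {Y V : Finset A} [Fintype X]

/-- A code of rate `R` whose probability of success is, up to a vanishing term, the probability `t`
that the information density of strategy and output exceeds `n * (R + δ)`. -/
theorem exists_channelCode (K : AdditiveNoiseFeedbackChannel X Y V)
    (q : InputDistribution X ↥(Y + V)) (n : ℕ) (R δ : ℝ) :
    ∃ (t : ℝ) (c : ChannelCode X Y ↥(Y + V) n ⌈(2 : ℝ) ^ (n * R)⌉₊), 0 ≤ t ∧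
      K.errorProb c ≤ 1 - t + 2 ^ (-(n * δ)) ∧
      K.condDirectedInfo q n - massEntropy (K.noiseMass n)
        ≤ n * (R + δ) * (1 - t) + t * (n * Real.logb 2 Y.card) + 1 / Real.log 2 := by
  classical
  let P : Strategy X ↥(Y + V) n → ℝ := fun g => Strategy.mass q g
  let W : Strategy X ↥(Y + V) n → (Fin n → Y) → ℝ := fun g y => K.outputMass g.code y
  have hP : ∀ g, 0 ≤ P g := fun g => Strategy.mass_nonneg q g
  have hP1 : ∑ g, P g = 1 := Strategy.sum_mass q
  have hW : ∀ g y, 0 ≤ W g y := fun g y => K.outputMass_nonneg _ _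
  have hW1 : ∀ g, ∑ y, W g y = 1 := fun g => K.sum_outputMass _
  set γ : ℝ := n * (R + δ) with hγ
  let T : Strategy X ↥(Y + V) n → (Fin n → Y) → Prop :=
    fun g y => 2 ^ γ * ∑ g', P g' * W g' y < W g y
  let t : ℝ := ∑ g, ∑ y, P g * W g y * (if T g y then 1 else 0)
  have ht0 : 0 ≤ t := Finset.sum_nonneg fun g _ => Finset.sum_nonneg fun y _ =>
    mul_nonneg (mul_nonneg (hP g) (hW g y)) (by split_ifs <;> norm_num)
  have hJ1 : ∑ g, ∑ y, P g * W g y = 1 := by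
    simp_rw [← Finset.mul_sum, hW1, mul_one, hP1]
  have ht1 : ∑ g, ∑ y, P g * W g y * (if T g y then 0 else 1) = 1 - t := by
    rw [show 1 - t = ∑ g, ∑ y, P g * W g y - t by rw [hJ1], ← Finset.sum_sub_distrib]
    refine Finset.sum_congr rfl fun g _ => ?_
    rw [← Finset.sum_sub_distrib]
    refine Finset.sum_congr rfl fun y _ => ?_
    split_ifs <;> simp
  have hT : ∀ g, ∑ y, (if T g y then ∑ g', P g' * W g' y else 0) ≤ (2 : ℝ) ^ (-γ) := by
    intro g
    calc ∑ y, (if T g y then ∑ g', P g' * W g' y else 0) ≤ ∑ y, (2 : ℝ) ^ (-γ) * W g y := by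
          refine Finset.sum_le_sum fun y _ => ?_
          split_ifs with h
          · rw [Real.rpow_neg two_pos.le, inv_mul_eq_div, le_div_iff₀ (by positivity), mul_comm]
            exact h.le
          · exact mul_nonneg (by positivity) (hW g y)
      _ = _ := by rw [← Finset.mul_sum, hW1, mul_one]
  have hpos : (0 : ℝ) < 2 ^ (n * R) := by positivity
  obtain ⟨c, d, hcd⟩ := exists_code hP hP1 hW T (κ := 2 ^ (-γ)) (by positivity) hT
    ⌈(2 : ℝ) ^ (n * R)⌉₊ (Nat.ceil_pos.mpr hpos)
  refine ⟨t, ⟨fun w => (c w).code, d⟩, ht0, ?_, ?_⟩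
  · rw [ht1] at hcd
    have h1 : ((⌈(2 : ℝ) ^ (n * R)⌉₊ : ℝ) - 1) * 2 ^ (-γ) ≤ 2 ^ (-(n * δ)) := by
      calc ((⌈(2 : ℝ) ^ (n * R)⌉₊ : ℝ) - 1) * 2 ^ (-γ) ≤ 2 ^ (n * R) * 2 ^ (-γ) := by
            gcongr
            linarith [Nat.ceil_lt_add_one hpos.le]
        _ = 2 ^ (-(n * δ)) := by
            rw [← Real.rpow_add two_pos, hγ]
            congr 1
            ring
    refine le_trans (le_of_eq ?_) (hcd.trans (by linarith))
    unfold errorProb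
    congr 1
  · refine (K.condDirectedInfo_sub_le q n).trans
      ((mutualInfo_le hP hP1 hW hW1 γ (t := t) ?_).trans (le_of_eq ?_))
    · refine Finset.sum_congr rfl fun g _ => Finset.sum_congr rfl fun y _ => ?_
      congr
    · simp [Real.logb_pow]

theorem le_liminf_logb_ceil (R : ℝ) :
    (R : EReal) ≤ liminf (fun n : ℕ =>
      ((Real.logb 2 (⌈(2 : ℝ) ^ (n * R)⌉₊ : ℕ) / n : ℝ) : EReal)) atTop := by
  refine le_liminf_of_le (by isBoundedDefault) ?_
  filter_upwards [eventually_gt_atTop 0] with n hn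
  rw [EReal.coe_le_coe_iff, le_div_iff₀ (by exact_mod_cast hn), mul_comm]
  have hpos : (0 : ℝ) < 2 ^ (n * R) := by positivity
  calc (n * R : ℝ) = Real.logb 2 (2 ^ (n * R)) := by
        rw [Real.logb_rpow two_pos (by norm_num)]
    _ ≤ _ := Real.logb_le_logb_of_le one_lt_two hpos (Nat.le_ceil _)

/-- Under the strong converse property no input distribution lets the conditional directed
information exceed the noise entropy by more than the capacity asymptotically. -/
theorem StrongConverse.not_eventually_lt {K : AdditiveNoiseFeedbackChannel X Y V}
    (hK : K.StrongConverse) (q : InputDistribution X ↥(Y + V)) {R δ : ℝ}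
    (hR : K.capacity < (R : EReal)) (hδ : 0 < δ) :
    ¬ ∀ᶠ n : ℕ in atTop, n * (R + 2 * δ)
      ≤ K.condDirectedInfo q n - massEntropy (K.noiseMass n) := by
  intro hev
  choose t c ht hc hI using fun n => K.exists_channelCode q n R δ
  have hlim := hK R hR _ c (le_liminf_logb_ceil R)
  set L : ℝ := Real.logb 2 Y.card with hL
  -- The added 1 keeps the divisor positive.
  set B : ℝ := |L - (R + δ)| + 1 with hB
  have hBpos : 0 < B := by positivity
  have hα : 0 < δ / (2 * B) := by positivity
  have hexp : Tendsto (fun n : ℕ => (2 : ℝ) ^ (-(n * δ))) atTop (𝓝 0) := by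
    have h := tendsto_pow_atTop_nhds_zero_of_lt_one (r := (2 : ℝ) ^ (-δ)) (by positivity)
      (Real.rpow_lt_one_of_one_lt_of_neg one_lt_two (by linarith))
    refine h.congr fun n => ?_
    rw [← Real.rpow_natCast, ← Real.rpow_mul two_pos.le]
    congr 1
    ring
  have hbound : ∀ᶠ n : ℕ in atTop, K.errorProb (c n) ≤ 1 - δ / (2 * B) + 2 ^ (-(n * δ)) := by
    -- For n ≥ 2/(δ log 2) the constant 1/log 2 uses up at most half of the surplus nδ; the other
    -- half forces t ≥ δ/(2B).
    filter_upwards [hev, eventually_gt_atTop 0,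
      (tendsto_natCast_atTop_atTop (R := ℝ)).eventually_ge_atTop (1 / Real.log 2 * 2 / δ)]
      with n hn hn0 hn1
    have hn0' : (0 : ℝ) < n := by exact_mod_cast hn0
    rw [div_le_iff₀ hδ] at hn1
    have h1 := hn.trans (hI n)
    have h2 : n * (δ / 2) ≤ n * (t n * (L - (R + δ))) := by linarith
    have h3 : δ / 2 ≤ t n * (L - (R + δ)) := le_of_mul_le_mul_left h2 hn0'
    have h4 : δ / 2 ≤ t n * B := h3.trans
      (mul_le_mul_of_nonneg_left (by linarith [le_abs_self (L - (R + δ))]) (ht n))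
    have h5 : δ / (2 * B) ≤ t n := by
      rw [← div_div, div_le_iff₀ hBpos]
      exact h4
    linarith [hc n]
  have := le_of_tendsto_of_tendsto hlim (hexp.const_add (1 - δ / (2 * B))) hbound
  linarith

/-- Needed, with the exclusion of ⊤, to treat the extended-real difference as a subtraction of a
real number. -/
theorem noiseEntropyRate_ne_bot (K : AdditiveNoiseFeedbackChannel X Y V) :
    K.noiseEntropyRate ≠ ⊥ := by
  have h : (0 : EReal) ≤ K.noiseEntropyRate := by
    refine le_limsup_of_le (by isBoundedDefault) fun b hb => ?_
    obtain ⟨n, hn⟩ := hb.exists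
    refine le_trans ?_ hn
    exact_mod_cast div_nonneg
      (massEntropy_nonneg (fun v => K.noiseMass_nonneg v) (K.sum_noiseMass n)) n.cast_nonneg
  exact ne_bot_of_le_ne_bot EReal.zero_ne_bot h

end AdditiveNoiseFeedbackChannel

open AdditiveNoiseFeedbackChannel Filter in
theorem upperBound_sub_noiseEntropyRate_le_capacity {X A : Type*} [Fintype X] [AddCommGroup A]
    [DecidableEq A] {Y V : Finset A} {K : AdditiveNoiseFeedbackChannel X Y V}
    (hK : K.StrongConverse) : K.upperBound - K.noiseEntropyRate ≤ K.capacity := by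
  by_contra! hlt
  obtain ⟨R, hCR, hR⟩ := EReal.lt_iff_exists_real_btwn.mp hlt
  have hbot := K.noiseEntropyRate_ne_bot
  have htop : K.noiseEntropyRate ≠ ⊤ := by
    intro h
    rw [h, EReal.sub_top] at hR
    exact not_lt_bot hR
  obtain ⟨h, hh⟩ : ∃ h : ℝ, K.noiseEntropyRate = (h : EReal) :=
    ⟨_, (EReal.coe_toReal htop hbot).symm⟩
  rw [hh, EReal.lt_sub_iff_add_lt (by simp) (by simp), upperBound, lt_iSup_iff] at hR
  obtain ⟨q, hq⟩ := hR
  obtain ⟨s, hs, hsq⟩ := EReal.lt_iff_exists_real_btwn.mp hq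
  rw [← EReal.coe_add, EReal.coe_lt_coe_iff] at hs
  -- The gap s - (R + h) is 4δ. Eventually I/n > s and H/n < h + 2δ, hence (I - H)/n > s - h - 2δ =
  -- R + 2δ.
  refine hK.not_eventually_lt q (δ := (s - (R + h)) / 4) hCR (by linarith) ?_
  have hH : limsup (fun n : ℕ => ((FiniteInfo.massEntropy (K.noiseMass n) / n : ℝ) : EReal)) atTop
      < ((h + (s - (R + h)) / 2 : ℝ) : EReal) := by
    change K.noiseEntropyRate < _
    rw [hh, EReal.coe_lt_coe_iff]
    linarith
  filter_upwards [eventually_lt_of_lt_liminf hsq, eventually_lt_of_limsup_lt hH,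
    eventually_gt_atTop 0] with n h1 h2 hn
  have hn' : (0 : ℝ) < n := by exact_mod_cast hn
  rw [EReal.coe_lt_coe_iff, lt_div_iff₀ hn'] at h1
  rw [EReal.coe_lt_coe_iff, div_lt_iff₀ hn'] at h2
  linarith

theorem theorem7 {X A : Type*} [Fintype X] [Nonempty X] [AddCommGroup A] [DecidableEq A]
    (Y V : Finset A) (K : AdditiveNoiseFeedbackChannel X Y V) (hK : K.StrongConverse) :
    K.upperBound - K.noiseEntropyRate ≤ K.capacity :=
  upperBound_sub_noiseEntropyRate_le_capacity hK
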